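/- **Setting.** Let $b,d\ge1$, let $p\ge 2$ be an even integer and let $j_1,\dots,j_b\in\mathbb Z^d\setminus\{0\}$ be distinct. Put $\omega_k=\omega^{(0)}_k=\sqrt{|j_k|^2+1}$. For $a=(a_1,\dots,a_b)$ with $a_k>0$ let $u^{(0)}$ be the function on $\mathbb Z^{b+d}$ with the value $a_k$ at $(-e_k,j_k)$, $k=1,\dots,b$, and $0$ elsewhere, and let $\bar u^{(0)}$ be the function with the value $a_k$ at $(e_k,-j_k)$ and $0$ elsewhere. On $\ell^2(\mathbb Z^{b+d})\times\ell^2(\mathbb Z^{b+d})$ let $A_0$ be the $2\times2$ block operator all four of whose blocks are convolution with the $p$-fold convolution power $(u^{(0)}+\bar u^{(0)})^{*p}$. Let $\mathcal C_\pm=\{(n,j)\in\mathbb Z^{b+d}:\ \pm n\cdot\omega^{(0)}+\sqrt{|j|^2+1}=0\}$ be the bi-characteristics, let $P_\pm$ be the orthogonal projection of $\ell^2(\mathbb Z^{b+d})$ onto the functions supported in $\mathcal C_\pm$, and let $P=\mathrm{diag}(P_+,P_-)$. **Genericity.** Let $B'=\frac{(d+1)(d+2)}2$, $B=B'+b(b+1)$;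 let $\Gamma$ be the set of all sums of $p$ elements of $\{\pm(-e_k,j_k)\}_{k=1}^b$; let $\mathcal A$ be the set of all sums of $B$ terms, each in $\Gamma$ or equal to $0$; and let $\mathcal G$ be the set of all $\alpha(e_{k'}-e_k,j_k-j_{k'})$, $k\ne k'$, and all $\alpha(-e_k,j_k)$, with $\alpha\in\mathbb Z\setminus\{0\}$. For $(\Delta n,\Delta j)\in\mathcal A$ (so that $\Delta j=-\sum_k\Delta n_k\,j_k$) let $$a_m=4(\Delta j^{(m)})^2-4(\Delta n\cdot\omega)^2,\quad b_{mm'}=8\Delta j^{(m)}\Delta j^{(m')}\ (m<m'),\quad c_m=[4|\Delta j|^2-4(\Delta n\cdot\omega)^2]\Delta j^{(m)},$$ $$L=(\{a_m\},\{b_{mm'}\},\{c_m\})\in\mathbb R^{B'-1},\qquad W=[|\Delta j|^2-(\Delta n\cdot\omega)^2]^2-4(\Delta n\cdot\omega)^2 .$$ For fixed $\Delta n$ these are functions of $(j_1,\dots,j_b)\in(\mathbb R^d)^b$. Assume that $u^{(0)}$ is generic in the following sense. (i) For all $(\Delta n,\Delta j)\in\mathcal A\setminus\{(0,0)\}$: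 $|\Delta j|^2+(\Delta n\cdot\omega)^2\ne0$, $|\Delta j|^2-(\Delta n\cdot\omega)^2\neq0$ and $W\ne0$. (ii) For every set $\sigma\subset\mathcal A\setminus\mathcal G$ of $B'$ elements, all with $\Delta j\ne0$, consider the $B'\times B'$ matrix $[[L,W]]$ whose rows are the vectors $(L,W)$ of the elements of $\sigma$. For every $1\le\rho\le B'-1$ and every $(\rho+1)\times\rho$ submatrix of its part $[[L]]$, none of whose $\rho\times\rho$ minors vanishes, let $D$ be the determinant of the $(\rho+1)\times(\rho+1)$ matrix obtained by adjoining to this submatrix the corresponding entries of the column $W$. If $D$, as a function of $(j_1,\dots,j_b)\in(\mathbb R^d)^b$ with the $\Delta n$'s and the chosen rows and columns held fixed, is not identically zero, then $D\neq0$ at the given $j_1,\dots,j_b$. **Proposition 1.** There are constants $C,c>0$ (not depending on $a$, $\epsilon$, $\delta$) such that for all $\epsilon>0$ and all $\delta\in(0,1]$ there is a measurable set $\mathbb B\subset(0,\delta]^b$ with $$\frac{\operatorname{meas}\mathbb B}{\delta^b}>1-C\epsilon^c$$ such that for every $a\in\mathbb B$ the operator $PA_0P$ is invertible on the range of $P$,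 and the operator norm of its inverse satisfies $$\big\|[PA_0P]^{-1}\big\|\le\big[\epsilon\,\|a\|_\infty^p\big]^{-1}.$$ -/

import Mathlib

open scoped ENNReal

noncomputable section

namespace NLW

/-- The Fourier lattice `ℤ^{b+d} = ℤ^b × ℤ^d`; a point is `(n, j)`. -/
abbrev Lattice (b d : ℕ) : Type := (Fin b → ℤ) × (Fin d → ℤ)

/-! ### Frequencies and bi-characteristics -/

/-- A family of integer vectors `j_1, …, j_b ∈ ℤ^d` seen in `(ℝ^d)^b`. -/
def toReal {b d : ℕ} (j : Fin b → Fin d → ℤ) : Fin b → Fin d → ℝ := fun k m => (j k m : ℝ)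

/-- The frequency vector `ω_k = √(|J_k|² + 1)`. -/
def omega {b d : ℕ} (J : Fin b → Fin d → ℝ) (k : Fin b) : ℝ :=
  Real.sqrt (∑ m, J k m ^ 2 + 1)

/-- `n · ω` for `n ∈ ℤ^b`. -/
def phase {b d : ℕ} (J : Fin b → Fin d → ℝ) (n : Fin b → ℤ) : ℝ :=
  ∑ k, (n k : ℝ) * omega J k

/-- `𝒞₊ = {(n, j) : n · ω + √(|j|² + 1) = 0}`. -/
def charPlus {b d : ℕ} (j : Fin b → Fin d → ℤ) : Set (Lattice b d) :=
  {x | phase (toReal j) x.1 + Real.sqrt (∑ m, (x.2 m : ℝ) ^ 2 + 1) = 0}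

/-- `𝒞₋ = {(n, j) : - n · ω + √(|j|² + 1) = 0}`. -/
def charMinus {b d : ℕ} (j : Fin b → Fin d → ℤ) : Set (Lattice b d) :=
  {x | -phase (toReal j) x.1 + Real.sqrt (∑ m, (x.2 m : ℝ) ^ 2 + 1) = 0}

/-! ### The convolution operator on `ℓ²(ℤ^{b+d}) × ℓ²(ℤ^{b+d})` -/

/-- `ℓ²(ℤ^{b+d})`, complex valued. -/
abbrev Ell2 (b d : ℕ) : Type := lp (fun _ : Lattice b d => ℂ) 2

/-- The Hilbert space `ℓ²(ℤ^{b+d}) × ℓ²(ℤ^{b+d})`. -/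
abbrev Ell2Pair (b d : ℕ) : Type := WithLp 2 (Ell2 b d × Ell2 b d)

theorem summable_sq {b d : ℕ} (f : Ell2 b d) :
    Summable fun x => ‖f x‖ ^ (2 : ℝ≥0∞).toReal :=
  (lp.memℓp f).summable (by norm_num)

/-- Translation by `z`: `(shift z f)(x) = f (x - z)`. -/
def shift {b d : ℕ} (z : Lattice b d) : Ell2 b d →L[ℂ] Ell2 b d :=
  LinearMap.mkContinuous
    { toFun := fun f => ⟨fun x => f (x - z),
        memℓp_gen ((Equiv.subRight z).summable_iff.2 (summable_sq f))⟩
      map_add' := fun _ _ => rfl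
      map_smul' := fun _ _ => rfl } 1 (by
    intro f
    rw [one_mul]
    refine lp.norm_le_of_tsum_le (by norm_num) (norm_nonneg f) ?_
    rw [lp.norm_rpow_eq_tsum (by norm_num) f]
    exact ((Equiv.subRight z).tsum_eq fun x => ‖f x‖ ^ (2 : ℝ≥0∞).toReal).le)

theorem norm_indicator_rpow_le {b d : ℕ} (S : Set (Lattice b d)) (f : Ell2 b d)
    (x : Lattice b d) :
    ‖S.indicator (fun y => f y) x‖ ^ (2 : ℝ≥0∞).toReal ≤ ‖f x‖ ^ (2 : ℝ≥0∞).toReal :=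
  Real.rpow_le_rpow (norm_nonneg _) (norm_indicator_le_norm_self _ _) (by norm_num)

/-- The orthogonal projection of `ℓ²(ℤ^{b+d})` onto the functions supported in `S`. -/
def proj {b d : ℕ} (S : Set (Lattice b d)) : Ell2 b d →L[ℂ] Ell2 b d :=
  LinearMap.mkContinuous
    { toFun := fun f => ⟨S.indicator fun x => f x,
        memℓp_gen ((summable_sq f).of_nonneg_of_le
          (fun _ => Real.rpow_nonneg (norm_nonneg _) _) (norm_indicator_rpow_le S f))⟩
      map_add' := fun f g => Subtype.ext (Set.indicator_add S (fun x => f x) fun x => g x)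
      map_smul' := fun c f => Subtype.ext (Set.indicator_const_smul S c fun x => f x) } 1 (by
    intro f
    rw [one_mul]
    refine lp.norm_le_of_forall_sum_le (by norm_num) (norm_nonneg f) fun s => ?_
    exact (Finset.sum_le_sum fun x _ => norm_indicator_rpow_le S f x).trans
      (lp.sum_rpow_le_norm_rpow (by norm_num) f s))

/-- Convolution with a finitely supported `w`: `(w * f)(x) = ∑_z w(z) f(x - z)`. -/
def conv {b d : ℕ} (w : AddMonoidAlgebra ℂ (Lattice b d)) : Ell2 b d →L[ℂ] Ell2 b d :=
  w.coeff.sum fun z c => c • shift z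

/-- The Fourier series of `u⁽⁰⁾`: the coefficient `a_k` at `(-e_k, j_k)`. -/
def uHat {b d : ℕ} (j : Fin b → Fin d → ℤ) (a : Fin b → ℝ) : AddMonoidAlgebra ℂ (Lattice b d) :=
  ∑ k, AddMonoidAlgebra.single (-Pi.single k 1, j k) (a k : ℂ)

/-- The Fourier series of the complex conjugate of `u⁽⁰⁾` (the amplitudes are real): the
coefficient `a_k` at `(e_k, -j_k)`. -/
def uBarHat {b d : ℕ} (j : Fin b → Fin d → ℤ) (a : Fin b → ℝ) :
    AddMonoidAlgebra ℂ (Lattice b d) :=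
  ∑ k, AddMonoidAlgebra.single (Pi.single k 1, -j k) (a k : ℂ)

/-- The operator `A₀`: the `2 × 2` block operator all of whose blocks are convolution with
`(u⁽⁰⁾ + ū⁽⁰⁾)^{*p}` (the product of the monoid algebra is convolution). -/
def A0 {b d : ℕ} (p : ℕ) (j : Fin b → Fin d → ℤ) (a : Fin b → ℝ) :
    Ell2Pair b d →L[ℂ] Ell2Pair b d :=
  let T := conv ((uHat j a + uBarHat j a) ^ p)
  (WithLp.prodContinuousLinearEquiv 2 ℂ (Ell2 b d) (Ell2 b d)).symm.toContinuousLinearMap ∘L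
    (((T.coprod T).prod (T.coprod T)) ∘L
      (WithLp.prodContinuousLinearEquiv 2 ℂ (Ell2 b d) (Ell2 b d)).toContinuousLinearMap)

/-- The projection `P = diag(P₊, P₋)` onto the bi-characteristics. -/
def P {b d : ℕ} (j : Fin b → Fin d → ℤ) : Ell2Pair b d →L[ℂ] Ell2Pair b d :=
  (WithLp.prodContinuousLinearEquiv 2 ℂ (Ell2 b d) (Ell2 b d)).symm.toContinuousLinearMap ∘L
    (((proj (charPlus j)).prodMap (proj (charMinus j))) ∘L
      (WithLp.prodContinuousLinearEquiv 2 ℂ (Ell2 b d) (Ell2 b d)).toContinuousLinearMap)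

/-- `R` is the inverse of `Q T Q` on the range of the orthogonal projection `Q`, extended by `0`
to the orthogonal complement of that range. Such an `R` is unique, and its norm is the norm of the
inverse of `Q T Q` as an operator on the range of `Q`. -/
def IsCompressionInverse {b d : ℕ} (Q T R : Ell2Pair b d →L[ℂ] Ell2Pair b d) : Prop :=
  Q ∘L R = R ∧ R ∘L Q = R ∧ R ∘L (Q ∘L T ∘L Q) = Q ∧ (Q ∘L T ∘L Q) ∘L R = Q

/-! ### Genericity -/

/-- `B' = (d+1)(d+2)/2`. -/
def Bprime (d : ℕ) : ℕ := (d + 1) * (d + 2) / 2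

/-- `B = (d+1)(d+2)/2 + b(b+1)`. -/
def B (b d : ℕ) : ℕ := Bprime d + b * (b + 1)

/-- `Γ`, the support of `(u⁽⁰⁾ + ū⁽⁰⁾)^{*p}`: all sums of `p` elements of
`{(-e_k, j_k)} ∪ {(e_k, -j_k)}`. -/
def Gam {b d : ℕ} (p : ℕ) (j : Fin b → Fin d → ℤ) : Set (Lattice b d) :=
  {x | ∃ s t : Fin b → ℕ, ∑ k, (s k + t k) = p ∧
    x = ∑ k, ((s k : ℤ) - (t k : ℤ)) • ((-Pi.single k 1, j k) : Lattice b d)}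

/-- `𝒜`: all sums of `B` terms, each of which lies in `Γ` or is `0`. -/
def calA {b d : ℕ} (p : ℕ) (j : Fin b → Fin d → ℤ) : Set (Lattice b d) :=
  {x | ∃ g : Fin (B b d) → Lattice b d, (∀ i, g i ∈ Gam p j ∨ g i = 0) ∧ x = ∑ i, g i}

/-- `𝒢`: the nonzero integer multiples of `(e_{k'} - e_k, j_k - j_{k'})`, `k ≠ k'`, and of
`(-e_k, j_k)`. -/
def calG {b d : ℕ} (j : Fin b → Fin d → ℤ) : Set (Lattice b d) :=
  {x | ∃ α : ℤ, α ≠ 0 ∧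
    ((∃ k k' : Fin b, k ≠ k' ∧
        x = α • ((Pi.single k' 1 - Pi.single k 1, j k - j k') : Lattice b d)) ∨
      ∃ k : Fin b, x = α • ((-Pi.single k 1, j k) : Lattice b d))}

/-- `Δj = -∑_k Δn_k J_k`, the space component that goes with the time component `Δn`, as a function
of `J ∈ (ℝ^d)^b`. -/
def deltaJ {b d : ℕ} (J : Fin b → Fin d → ℝ) (n : Fin b → ℤ) (m : Fin d) : ℝ :=
  -∑ k, (n k : ℝ) * J k m

/-- `|Δj|²`. -/
def sqJ {b d : ℕ} (J : Fin b → Fin d → ℝ) (n : Fin b → ℤ) : ℝ := ∑ m, deltaJ J n m ^ 2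

theorem Gam_snd {b d p : ℕ} {j : Fin b → Fin d → ℤ} {x : Lattice b d} (hx : x ∈ Gam p j)
    (m : Fin d) : (x.2 m : ℝ) = deltaJ (toReal j) x.1 m := by
  obtain ⟨s, t, -, rfl⟩ := hx
  have h1 : ∀ k, (∑ i, ((s i : ℤ) - (t i : ℤ)) • ((-Pi.single i 1, j i) : Lattice b d)).1 k
      = -((s k : ℤ) - (t k : ℤ)) := by
    intro k
    simp [Prod.fst_sum, Finset.sum_apply, Pi.single_apply, mul_ite, Finset.sum_neg_distrib]
  simp only [deltaJ, h1]
  simp only [Prod.snd_sum, Finset.sum_apply, Prod.smul_snd, Pi.smul_apply, smul_eq_mul, toReal]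
  push_cast
  rw [← Finset.sum_neg_distrib]
  exact Finset.sum_congr rfl fun k _ => by ring

/-- On `𝒜` the formula `Δj = -∑_k Δn_k j_k` gives the actual space component. -/
theorem calA_snd {b d p : ℕ} {j : Fin b → Fin d → ℤ} {x : Lattice b d} (hx : x ∈ calA p j)
    (m : Fin d) : (x.2 m : ℝ) = deltaJ (toReal j) x.1 m := by
  obtain ⟨g, hg, rfl⟩ := hx
  have h : ∀ i, ((g i).2 m : ℝ) = deltaJ (toReal j) (g i).1 m := by
    intro i
    rcases hg i with h | h
    · exact Gam_snd h m
    · simp [h, deltaJ]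
  have h2 : (((∑ i, g i).2 m : ℤ) : ℝ) = ∑ i, ((g i).2 m : ℝ) := by
    simp [Prod.snd_sum, Finset.sum_apply]
  rw [h2, Finset.sum_congr rfl fun i _ => h i]
  simp only [deltaJ, Prod.fst_sum, Finset.sum_apply, Int.cast_sum, Finset.sum_mul,
    Finset.sum_neg_distrib]
  rw [Finset.sum_comm]

/-- Index set of the entries of `L`: `d` entries `a_m`, `d(d-1)/2` entries `b_ℓ` (unordered pairs
`m ≠ m'`, listed as `m < m'`), `d` entries `c_m`. -/
abbrev LIdx (d : ℕ) : Type := Fin d ⊕ {q : Fin d × Fin d // q.1 < q.2} ⊕ Fin d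

/-- The vector `L = ({a_m}, {b_ℓ}, {c_m})` of `(Δn, Δj)`, as a function of `J`. -/
def Lvec {b d : ℕ} (J : Fin b → Fin d → ℝ) (n : Fin b → ℤ) : LIdx d → ℝ
  | Sum.inl m => 4 * deltaJ J n m ^ 2 - 4 * phase J n ^ 2
  | Sum.inr (Sum.inl q) => 8 * deltaJ J n q.1.1 * deltaJ J n q.1.2
  | Sum.inr (Sum.inr m) => (4 * sqJ J n - 4 * phase J n ^ 2) * deltaJ J n m

/-- `W = (|Δj|² - (Δn·ω)²)² - 4 (Δn·ω)²`, as a function of `J`. -/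
def Wval {b d : ℕ} (J : Fin b → Fin d → ℝ) (n : Fin b → ℤ) : ℝ :=
  (sqJ J n - phase J n ^ 2) ^ 2 - 4 * phase J n ^ 2

/-- The determinant of the `ρ × ρ` submatrix of `L` obtained from the `ρ + 1` rows by leaving out
row `i₀`. -/
def minorL {b d ρ : ℕ} (J : Fin b → Fin d → ℝ) (rows : Fin (ρ + 1) → Lattice b d)
    (cols : Fin ρ → LIdx d) (i₀ : Fin (ρ + 1)) : ℝ :=
  (Matrix.of fun i q : Fin ρ => Lvec J (rows (i₀.succAbove i)).1 (cols q)).det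

/-- The determinant of the `(ρ+1) × (ρ+1)` matrix `[[L, W]]`: the chosen `ρ` columns of `L`,
followed by the column `W`. -/
def detLW {b d ρ : ℕ} (J : Fin b → Fin d → ℝ) (rows : Fin (ρ + 1) → Lattice b d)
    (cols : Fin ρ → LIdx d) : ℝ :=
  (Matrix.of fun i : Fin (ρ + 1) =>
    (Fin.snoc (fun q => Lvec J (rows i).1 (cols q)) (Wval J (rows i).1) :
      Fin (ρ + 1) → ℝ)).det

/-- Genericity condition (i). -/
def CondI {b d : ℕ} (p : ℕ) (j : Fin b → Fin d → ℤ) : Prop :=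
  ∀ x ∈ calA p j, x ≠ 0 →
    sqJ (toReal j) x.1 + phase (toReal j) x.1 ^ 2 ≠ 0 ∧
    sqJ (toReal j) x.1 - phase (toReal j) x.1 ^ 2 ≠ 0 ∧
    Wval (toReal j) x.1 ≠ 0

/-- Genericity condition (ii). It is required for those determinants `D` that are not identically
zero as functions of `J ∈ (ℝ^d)^b`, so that each one excludes a set of codimension one. (For two
opposite rows `(Δn, Δj)`, `(-Δn, -Δj)` and `ρ = 1` with a column `a_m` or `b_ℓ`, for instance,
`D` vanishes identically.) -/
def CondII {b d : ℕ} (p : ℕ) (j : Fin b → Fin d → ℤ) : Prop :=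
  ∀ σ : Finset (Lattice b d), (σ : Set (Lattice b d)) ⊆ calA p j \ calG j →
    σ.card = Bprime d → (∀ x ∈ σ, x.2 ≠ 0) →
    ∀ ρ : ℕ, 1 ≤ ρ → ρ ≤ Bprime d - 1 →
    ∀ rows : Fin (ρ + 1) ↪ Lattice b d, (∀ i, rows i ∈ σ) →
    ∀ cols : Fin ρ ↪ LIdx d,
      (∀ i₀, minorL (toReal j) rows cols i₀ ≠ 0) →
      (∃ J : Fin b → Fin d → ℝ, detLW J rows cols ≠ 0) →
      detLW (toReal j) rows cols ≠ 0

/-- `u⁽⁰⁾`, with Fourier support `{(-e_k, j_k)}`, is generic: the `j_k` are distinct and satisfy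
conditions (i) and (ii). -/
structure Generic {b d : ℕ} (p : ℕ) (j : Fin b → Fin d → ℤ) : Prop where
  injective : Function.Injective j
  condI : CondI p j
  condII : CondII p j

end NLW

end

/-! Write `p = 2m` and let `T` be convolution with `u⁽⁰⁾ + ū⁽⁰⁾`, which is self-adjoint. For `x` in
the range of `P` the quadratic form of `A₀` is `‖T^m (x₁ + x₂)‖²`, and `‖x₁ + x₂‖ = ‖x‖` because
`𝒞₊` and `𝒞₋` are disjoint. So it suffices to bound `‖T^m φ‖` below for `φ` supported in `𝒞 = 𝒞₊ ∪
𝒞₋` (`exists_norm_le_waveOp_pow`); coercivity then gives the inverse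
(`exists_isCompressionInverse`).

Choose `k₀` with `|j_k|` maximal. A linear functional of `(n·ω, j)` is strictly largest, on the
support of `u⁽⁰⁾ + ū⁽⁰⁾`, at the site of `k₀`. Translating that site to the origin turns `T^m` into
`a_{k₀}^m + r`, where every step of `r` lowers the functional. The compression of `r` to `𝒞` is
nilpotent: a nonzero power yields a chain of distinct points of `𝒞`, and `(n·ω, j)` maps `𝒞` into a
Lorentz hyperboloid, where chains with steps in a finite set have bounded length
(`exists_chain_bound`). A finite Neumann series bounds `φ` by `T^m φ`, with loss a power of `‖a‖ /
a_{k₀}`.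

Hence the only amplitudes to discard are those with `a_{k₀}` small compared with `δ`. -/

namespace NLW

/-! ### Chains on the Lorentz hyperboloid -/

/-- The Lorentz form `v₀ w₀ - v⃗ · w⃗` on `ℝ^{1+d}`. -/
def lorentz (d : ℕ) : (ℝ × (Fin d → ℝ)) →ₗ[ℝ] (ℝ × (Fin d → ℝ)) →ₗ[ℝ] ℝ :=
  LinearMap.mk₂ ℝ (fun v w => v.1 * w.1 - v.2 ⬝ᵥ w.2)
    (fun _ _ _ => by simp [add_dotProduct]; ring) (fun _ _ _ => by simp; ring)
    (fun _ _ _ => by simp [dotProduct_add]; ring) (fun _ _ _ => by simp; ring)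

theorem lorentz_apply {d : ℕ} (v w : ℝ × (Fin d → ℝ)) :
    lorentz d v w = v.1 * w.1 - v.2 ⬝ᵥ w.2 := rfl

theorem lorentz_comm {d : ℕ} (v w : ℝ × (Fin d → ℝ)) : lorentz d v w = lorentz d w v := by
  rw [lorentz_apply, lorentz_apply, dotProduct_comm, mul_comm]

/-- A null vector orthogonal to a timelike vector vanishes. -/
theorem eq_zero_of_lorentz_null {d : ℕ} {y w : ℝ × (Fin d → ℝ)} (hy : lorentz d y y = 1)
    (hyw : lorentz d y w = 0) (hw : lorentz d w w = 0) : w = 0 := by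
  rw [lorentz_apply] at hy hyw hw
  -- With the three relations substituted, Cauchy–Schwarz reads `(y₀w₀)² ≤ (y₀² - 1) w₀²`, so `w₀ =
  -- 0`.
  have hcs : (y.2 ⬝ᵥ w.2) ^ 2 ≤ (y.2 ⬝ᵥ y.2) * (w.2 ⬝ᵥ w.2) := by
    simpa [dotProduct, sq] using Finset.sum_mul_sq_le_sq_mul_sq Finset.univ y.2 w.2
  have h1 : y.2 ⬝ᵥ y.2 = y.1 * y.1 - 1 := by linarith
  have h2 : w.2 ⬝ᵥ w.2 = w.1 * w.1 := by linarith
  have h3 : y.2 ⬝ᵥ w.2 = y.1 * w.1 := by linarith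
  rw [h1, h2, h3] at hcs
  have h4 : w.1 = 0 := by nlinarith [mul_self_nonneg w.1]
  rw [h4, mul_zero] at h2
  exact Prod.ext h4 (dotProduct_self_eq_zero.1 h2)

/-- Chains of distinct points on the hyperboloid, with steps in a fixed finite set and in a subspace
of bounded dimension, have bounded length. -/
theorem exists_chain_bound_of_finrank {d : ℕ} {D : Set (ℝ × (Fin d → ℝ))} (hD : D.Finite) (k : ℕ) :
    ∃ N : ℕ, ∀ V : Submodule ℝ (ℝ × (Fin d → ℝ)), Module.finrank ℝ V ≤ k →
      ∀ w : ℕ → ℝ × (Fin d → ℝ), (∀ i < N, w (i + 1) - w i ∈ D ∧ w (i + 1) - w i ∈ V) →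
        (∀ i ≤ N, lorentz d (w i) (w i) = 1) → ¬ Set.InjOn w (Set.Iic N) := by
  induction k with
  | zero =>
    refine ⟨1, fun V hV w hs _ hinj => ?_⟩
    have hV0 : V = ⊥ := Submodule.finrank_eq_zero.1 (Nat.le_zero.1 hV)
    have h := (hs 0 zero_lt_one).2
    rw [hV0, Submodule.mem_bot, sub_eq_zero] at h
    simpa using hinj (by simp) (by simp) h
  | succ k ih =>
    obtain ⟨M, hM⟩ := ih
    have : Fintype D := hD.fintype
    -- Room for one more starting position than there are words of `M` steps, so some word occurs
    -- twice.
    refine ⟨Fintype.card (Fin M → D) + M, fun V hV w hs hQ hinj => ?_⟩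
    set c := Fintype.card (Fin M → D) with hc
    let word : Fin (c + 1) → Fin M → D := fun i t =>
      ⟨w (i + t + 1) - w (i + t), (hs _ (by have := i.2; have := t.2; omega)).1⟩
    obtain ⟨i, i', hne, heq⟩ := Fintype.exists_ne_map_eq_of_card_lt word (by simp [hc])
    have hi := i.2
    have hi' := i'.2
    have hdiff : ∀ t ≤ M, w (i' + t) - w (i + t) = w i' - w i := by
      intro t
      induction t with
      | zero => simp
      | succ t iht =>
        intro ht
        have h1 := congrArg Subtype.val (congrFun heq ⟨t, ht⟩)
        simp only [word] at h1
        have h2 := iht (Nat.le_of_succ_le ht)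
        rw [← h2, ← add_assoc, ← add_assoc, sub_eq_sub_iff_sub_eq_sub]
        exact h1.symm
    set u := w i' - w i with hu
    -- Both `w (i + t)` and its translate by `u` lie on the hyperboloid; subtract the two equations.
    have horth : ∀ t ≤ M, 2 * lorentz d (w (i + t)) u + lorentz d u u = 0 := by
      intro t ht
      have h1 := hQ (i + t) (by omega)
      have h2 := hQ (i' + t) (by omega)
      rw [← sub_add_cancel (w (i' + t)) (w (i + t)), hdiff t ht] at h2
      simp only [map_add, LinearMap.add_apply] at h2
      rw [lorentz_comm u (w (i + t))] at h2
      linarith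
    let V' : Submodule ℝ (ℝ × (Fin d → ℝ)) :=
      Submodule.span ℝ (Set.range fun t : Fin M => w (i + t + 1) - w (i + t))
    have hV'V : V' ≤ V := by
      refine Submodule.span_le.2 ?_
      rintro _ ⟨t, rfl⟩
      exact (hs _ (by have := t.2; omega)).2
    -- Otherwise the repeated stretch is itself a chain forbidden by the choice of `M`. Hence its
    -- steps span all of `V`.
    have hrank : k < Module.finrank ℝ V' := by
      by_contra hlt
      refine hM V' (not_lt.1 hlt) (fun t => w (i + t)) (fun t ht => ⟨?_, ?_⟩)
        (fun t ht => hQ _ (by omega)) fun s hs t ht hst => ?_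
      · exact (hs (i + t) (by omega)).1
      · exact Submodule.subset_span ⟨⟨t, ht⟩, rfl⟩
      · simp only [Set.mem_Iic] at hs ht
        have := hinj (x₁ := (i : ℕ) + s) (x₂ := (i : ℕ) + t)
          (Set.mem_Iic.2 (by omega)) (Set.mem_Iic.2 (by omega)) hst
        omega
    have hVV : V' = V := Submodule.eq_of_le_of_finrank_le hV'V (hV.trans hrank)
    have hmem : ∀ t ≤ c + M, w t - w 0 ∈ V := by
      intro t
      induction t with
      | zero => simp
      | succ t iht =>
        intro ht
        rw [← sub_add_sub_cancel _ (w t)]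
        exact V.add_mem (hs t ht).2 (iht (Nat.le_of_succ_le ht))
    have huV : u ∈ V' := by
      rw [hVV, hu, ← sub_sub_sub_cancel_right _ _ (w 0)]
      exact V.sub_mem (hmem _ (by omega)) (hmem _ (by omega))
    -- Consecutive relations `horth` differ by a step paired with `u`, so `u` is orthogonal to `V'`,
    -- which contains `u`: it is null.
    have hker : V' ≤ LinearMap.ker ((lorentz d).flip u) := by
      refine Submodule.span_le.2 ?_
      rintro _ ⟨t, rfl⟩
      have h1 := horth t t.2.le
      have h2 := horth (t + 1) t.2
      rw [← add_assoc] at h2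
      simp only [SetLike.mem_coe, LinearMap.mem_ker, LinearMap.flip_apply, map_sub]
      linarith
    have huu : lorentz d u u = 0 := hker huV
    have h0 := horth 0 (Nat.zero_le _)
    rw [huu, add_zero, add_zero] at h0
    have hu0 := eq_zero_of_lorentz_null (hQ i (by omega)) (by linarith) huu
    refine hne (Fin.ext (hinj (Set.mem_Iic.2 (by omega)) (Set.mem_Iic.2 (by omega)) ?_))
    rw [hu, sub_eq_zero] at hu0
    exact hu0.symm

theorem exists_chain_bound {d : ℕ} {D : Set (ℝ × (Fin d → ℝ))} (hD : D.Finite) :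
    ∃ N : ℕ, ∀ w : ℕ → ℝ × (Fin d → ℝ), (∀ i < N, w (i + 1) - w i ∈ D) →
        (∀ i ≤ N, lorentz d (w i) (w i) = 1) → ¬ Set.InjOn w (Set.Iic N) := by
  obtain ⟨N, hN⟩ :=
    exists_chain_bound_of_finrank hD (Module.finrank ℝ (⊤ : Submodule ℝ (ℝ × (Fin d → ℝ))))
  exact ⟨N, fun w hw => hN ⊤ le_rfl w fun i hi => ⟨hw i hi, Submodule.mem_top⟩⟩

end NLW

noncomputable section

namespace NLW

/-! ### Convolution operators -/

theorem shift_apply {b d : ℕ} (z : Lattice b d) (f : Ell2 b d) (x : Lattice b d) :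
    shift z f x = f (x - z) := rfl

theorem norm_shift_le {b d : ℕ} (z : Lattice b d) : ‖shift z‖ ≤ 1 :=
  LinearMap.mkContinuous_norm_le _ zero_le_one _

theorem proj_apply {b d : ℕ} (S : Set (Lattice b d)) (f : Ell2 b d) (x : Lattice b d) :
    proj S f x = S.indicator (fun y => f y) x := rfl

theorem norm_proj_le {b d : ℕ} (S : Set (Lattice b d)) : ‖proj S‖ ≤ 1 :=
  LinearMap.mkContinuous_norm_le _ zero_le_one _

theorem proj_proj {b d : ℕ} (S : Set (Lattice b d)) (f : Ell2 b d) :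
    proj S (proj S f) = proj S f := by
  ext x
  simp only [proj_apply]
  by_cases hx : x ∈ S <;> simp [hx]

theorem shift_zero {b d : ℕ} : shift (0 : Lattice b d) = 1 := by
  ext f x
  simp [shift_apply]

theorem shift_add {b d : ℕ} (z z' : Lattice b d) : shift (z + z') = shift z * shift z' := by
  ext f x
  simp [shift_apply, sub_sub]

/-- Convolution as a homomorphism of algebras. -/
def convHom (b d : ℕ) : AddMonoidAlgebra ℂ (Lattice b d) →ₐ[ℂ] (Ell2 b d →L[ℂ] Ell2 b d) :=
  AddMonoidAlgebra.lift ℂ _ _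
    { toFun := fun z => shift z.toAdd
      map_one' := shift_zero
      map_mul' := fun z z' => shift_add z.toAdd z'.toAdd }

theorem conv_eq_convHom {b d : ℕ} (w : AddMonoidAlgebra ℂ (Lattice b d)) :
    conv w = convHom b d w := by
  rw [convHom, AddMonoidAlgebra.lift_apply]
  rfl

theorem convHom_single {b d : ℕ} (z : Lattice b d) (c : ℂ) :
    convHom b d (AddMonoidAlgebra.single z c) = c • shift z := by
  rw [convHom, AddMonoidAlgebra.lift_single]
  rfl

theorem inner_shift_left {b d : ℕ} (z : Lattice b d) (f g : Ell2 b d) :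
    inner ℂ (shift z f) g = inner ℂ f (shift (-z) g) := by
  rw [lp.inner_eq_tsum, lp.inner_eq_tsum, ← (Equiv.addRight z).tsum_eq]
  simp [shift_apply]

/-- The point `(-e_k, j_k)` of the Fourier support of `u⁽⁰⁾`. -/
def site {b d : ℕ} (j : Fin b → Fin d → ℤ) (k : Fin b) : Lattice b d := (-Pi.single k 1, j k)

/-- Convolution with `u⁽⁰⁾ + ū⁽⁰⁾`. -/
def waveOp {b d : ℕ} (j : Fin b → Fin d → ℤ) (a : Fin b → ℝ) : Ell2 b d →L[ℂ] Ell2 b d :=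
  ∑ k, (a k : ℂ) • (shift (site j k) + shift (-site j k))

theorem convHom_uHat_add_uBarHat {b d : ℕ} (j : Fin b → Fin d → ℤ) (a : Fin b → ℝ) :
    convHom b d (uHat j a + uBarHat j a) = waveOp j a := by
  simp only [uHat, uBarHat, map_add, map_sum, convHom_single, waveOp, smul_add,
    Finset.sum_add_distrib, site, Prod.neg_mk, neg_neg]

theorem norm_waveOp_le {b d : ℕ} (j : Fin b → Fin d → ℤ) (a : Fin b → ℝ) :
    ‖waveOp j a‖ ≤ 2 * b * ‖a‖ := by
  have h : ∀ k ∈ Finset.univ, ‖(a k : ℂ) • (shift (site j k) + shift (-site j k))‖ ≤ 2 * ‖a‖ := by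
    intro k _
    rw [norm_smul, Complex.norm_real, mul_comm]
    refine mul_le_mul ?_ (norm_le_pi_norm a k) (norm_nonneg _) zero_le_two
    linarith [norm_add_le (shift (site j k)) (shift (-site j k)), norm_shift_le (site j k),
      norm_shift_le (-site j k)]
  refine (norm_sum_le_of_le _ h).trans_eq ?_
  simp
  ring

/-- The amplitudes are real and the support is symmetric under negation. -/
theorem inner_waveOp_left {b d : ℕ} (j : Fin b → Fin d → ℤ) (a : Fin b → ℝ) (f g : Ell2 b d) :
    inner ℂ (waveOp j a f) g = inner ℂ f (waveOp j a g) := by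
  simp only [waveOp, sum_apply, smul_apply,
    add_apply, sum_inner, inner_sum, inner_smul_left, inner_smul_right,
    inner_add_left, inner_add_right, inner_shift_left, neg_neg, Complex.conj_ofReal]
  exact Finset.sum_congr rfl fun k _ => by rw [add_comm]

theorem inner_waveOp_pow {b d : ℕ} (j : Fin b → Fin d → ℤ) (a : Fin b → ℝ) (m : ℕ)
    (f g : Ell2 b d) : inner ℂ ((waveOp j a ^ m) f) g = inner ℂ f ((waveOp j a ^ m) g) := by
  induction m generalizing f g with
  | zero => rfl
  | succ m ih =>
    rw [pow_succ, mul_apply_eq_comp, ih, inner_waveOp_left, ← pow_succ, pow_succ']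
    rfl

/-- The parity of `p` enters here: an even power of a self-adjoint operator has a square as its
quadratic form. -/
theorem inner_waveOp_pow_self {b d : ℕ} (j : Fin b → Fin d → ℤ) (a : Fin b → ℝ) (m : ℕ)
    (f : Ell2 b d) : inner ℂ ((waveOp j a ^ (m + m)) f) f = (‖(waveOp j a ^ m) f‖ ^ 2 : ℂ) := by
  rw [pow_add, mul_apply_eq_comp, inner_waveOp_pow, inner_self_eq_norm_sq_to_K]
  rfl

/-! ### Local operators -/

/-- The value of `r ψ` at `x` only depends on the values of `ψ` on `x - E`. -/
def IsLocal {b d : ℕ} (E : Set (Lattice b d)) (r : Ell2 b d →L[ℂ] Ell2 b d) : Prop :=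
  ∀ ψ x, r ψ x ≠ 0 → ∃ η ∈ E, ψ (x - η) ≠ 0

theorem IsLocal.mono {b d : ℕ} {E F : Set (Lattice b d)} {r : Ell2 b d →L[ℂ] Ell2 b d}
    (h : IsLocal E r) (hEF : E ⊆ F) : IsLocal F r := fun ψ x hx =>
  let ⟨η, hη, h'⟩ := h ψ x hx
  ⟨η, hEF hη, h'⟩

theorem IsLocal.add {b d : ℕ} {E : Set (Lattice b d)} {r s : Ell2 b d →L[ℂ] Ell2 b d}
    (hr : IsLocal E r) (hs : IsLocal E s) : IsLocal E (r + s) := by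
  intro ψ x hx
  by_cases h : r ψ x = 0
  · refine hs ψ x fun h' => hx ?_
    rw [add_apply, lp.coeFn_add, Pi.add_apply, h, h', add_zero]
  · exact hr ψ x h

theorem IsLocal.smul {b d : ℕ} {E : Set (Lattice b d)} {r : Ell2 b d →L[ℂ] Ell2 b d}
    (hr : IsLocal E r) (c : ℂ) : IsLocal E (c • r) := by
  intro ψ x hx
  refine hr ψ x fun h => hx ?_
  rw [smul_apply, lp.coeFn_smul, Pi.smul_apply, h, smul_zero]

theorem IsLocal.sum {b d : ℕ} {ι : Type*} {E : Set (Lattice b d)}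
    {r : ι → Ell2 b d →L[ℂ] Ell2 b d} (s : Finset ι) (hr : ∀ i ∈ s, IsLocal E (r i)) :
    IsLocal E (∑ i ∈ s, r i) :=
  Finset.sum_induction r (IsLocal E) (fun _ _ => IsLocal.add) (fun _ _ h => absurd rfl h) hr

theorem isLocal_shift {b d : ℕ} {E : Set (Lattice b d)} {z : Lattice b d} (hz : z ∈ E) :
    IsLocal E (shift z) := fun _ _ hx => ⟨z, hz, hx⟩

theorem isLocal_one {b d : ℕ} {E : Set (Lattice b d)} (h : 0 ∈ E) :
    IsLocal E (1 : Ell2 b d →L[ℂ] Ell2 b d) := shift_zero (b := b) (d := d) ▸ isLocal_shift h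

open scoped Pointwise in
theorem IsLocal.mul {b d : ℕ} {E F : Set (Lattice b d)} {r s : Ell2 b d →L[ℂ] Ell2 b d}
    (hr : IsLocal E r) (hs : IsLocal F s) : IsLocal (E + F) (r * s) := by
  intro ψ x hx
  obtain ⟨η, hη, h⟩ := hr _ _ hx
  obtain ⟨η', hη', h'⟩ := hs _ _ h
  exact ⟨η + η', Set.add_mem_add hη hη', by rwa [← sub_sub]⟩

open scoped Pointwise in
/-- The sums of between one and `m` elements of `E`. -/
def powSteps {b d : ℕ} (E : Set (Lattice b d)) : ℕ → Set (Lattice b d)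
  | 0 => ∅
  | m + 1 => (insert 0 E + powSteps E m) ∪ E

theorem finite_powSteps {b d : ℕ} {E : Set (Lattice b d)} (hE : E.Finite) (m : ℕ) :
    (powSteps E m).Finite := by
  induction m with
  | zero => exact Set.finite_empty
  | succ m ih => exact ((hE.insert 0).add ih).union hE

/-- The empty sum is excluded from `powSteps`, so the inequality stays strict. -/
theorem neg_of_mem_powSteps {b d : ℕ} {E : Set (Lattice b d)} (l : Lattice b d →+ ℝ)
    (hl : ∀ η ∈ E, l η < 0) (m : ℕ) : ∀ η ∈ powSteps E m, l η < 0 := by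
  induction m with
  | zero => exact fun _ h => absurd h (Set.notMem_empty _)
  | succ m ih =>
    rintro _ (⟨η, hη, η', hη', rfl⟩ | h)
    · have h' := ih η' hη'
      simp only [map_add]
      rcases hη with rfl | hη
      · simpa using h'
      · linarith [hl η hη]
    · exact hl _ h

/-- Once the scalar `c ^ m` is removed, every term of `h ^ m` contains at least one step from `E`.
-/
theorem IsLocal.pow_sub {b d : ℕ} {E : Set (Lattice b d)} {h : Ell2 b d →L[ℂ] Ell2 b d} {c : ℂ}
    (hh : IsLocal E (h - c • 1)) (m : ℕ) : IsLocal (powSteps E m) (h ^ m - c ^ m • 1) := by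
  induction m with
  | zero =>
    intro ψ x hx
    exact absurd (by simp) hx
  | succ m ih =>
    have h1 : h ^ (m + 1) - c ^ (m + 1) • (1 : Ell2 b d →L[ℂ] Ell2 b d)
        = h * (h ^ m - c ^ m • 1) + c ^ m • (h - c • 1) := by
      rw [mul_sub, mul_smul_comm, mul_one, smul_sub, smul_smul, ← pow_succ, ← pow_succ']
      abel
    have h2 : IsLocal (insert 0 E) h := by
      rw [← sub_add_cancel h (c • 1)]
      exact (hh.mono (Set.subset_insert _ _)).add ((isLocal_one (Set.mem_insert _ _)).smul c)
    rw [h1]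
    exact ((h2.mul ih).mono Set.subset_union_left).add
      ((hh.smul _).mono Set.subset_union_right)

/-- Nonvanishing of an iterated compression of a local operator produces a chain in `S`. -/
theorem IsLocal.exists_chain {b d : ℕ} {E S : Set (Lattice b d)} {r : Ell2 b d →L[ℂ] Ell2 b d}
    (hr : IsLocal E r) (n : ℕ) (ψ : Ell2 b d) (x : Lattice b d)
    (hx : ((proj S * r * proj S) ^ n) (proj S ψ) x ≠ 0) :
    ∃ w : ℕ → Lattice b d, w 0 = x ∧ (∀ i < n, w i - w (i + 1) ∈ E) ∧ ∀ i ≤ n, w i ∈ S := by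
  induction n generalizing x with
  | zero =>
    refine ⟨fun _ => x, rfl, fun i hi => absurd hi (Nat.not_lt_zero i), fun _ _ => ?_⟩
    by_contra h
    exact hx (Set.indicator_of_notMem h _)
  | succ n ih =>
    rw [pow_succ'] at hx
    change proj S (r (proj S (((proj S * r * proj S) ^ n) (proj S ψ)))) x ≠ 0 at hx
    rw [proj_apply] at hx
    have hxS := Set.mem_of_indicator_ne_zero hx
    rw [Set.indicator_of_mem hxS] at hx
    obtain ⟨η, hη, h⟩ := hr _ _ hx
    rw [proj_apply, Set.indicator_of_mem (Set.mem_of_indicator_ne_zero h)] at h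
    obtain ⟨w, hw0, hwE, hwS⟩ := ih _ h
    refine ⟨fun i => Nat.casesOn i x w, rfl, ?_, ?_⟩
    · rintro (_ | i) hi
      · simpa [hw0] using hη
      · exact hwE i (by omega)
    · rintro (_ | i) hi
      · exact hxS
      · exact hwS i (by omega)

/-- Finite Neumann series: substitute the equation into itself `n` times. The remainder disappears
once `K ^ n` kills `x`. -/
theorem norm_le_of_eq_sub {E : Type*} [NormedAddCommGroup E] [NormedSpace ℂ E] {K : E →L[ℂ] E}
    {x g : E} {κ : ℝ} (hx : x = g - K x) (hK : ‖K‖ ≤ κ) (hκ : 1 ≤ κ) (n : ℕ) :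
    ‖x‖ ≤ n * κ ^ n * ‖g‖ + ‖(K ^ n) x‖ := by
  induction n with
  | zero => simp
  | succ n ih =>
    have h1 : (K ^ n) x = (K ^ n) g - (K ^ (n + 1)) x := by
      conv_lhs => rw [hx]
      rw [map_sub, pow_succ]
      rfl
    have h2 : ‖(K ^ n) g‖ ≤ κ ^ n * ‖g‖ := by
      refine ((K ^ n).le_opNorm g).trans (mul_le_mul_of_nonneg_right ?_ (norm_nonneg g))
      rcases Nat.eq_zero_or_pos n with rfl | hn
      · rw [pow_zero, pow_zero]
        exact ContinuousLinearMap.norm_id_le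
      · exact (norm_pow_le' K hn).trans (pow_le_pow_left₀ (norm_nonneg K) hK n)
    have h3 : κ ^ n ≤ κ ^ (n + 1) := pow_le_pow_right₀ hκ n.le_succ
    have h4 : ‖(K ^ n) x‖ ≤ ‖(K ^ n) g‖ + ‖(K ^ (n + 1)) x‖ := h1 ▸ norm_sub_le _ _
    have h5 : (n + 1 : ℝ) * κ ^ n * ‖g‖ ≤ (n + 1) * κ ^ (n + 1) * ‖g‖ := by gcongr
    rw [Nat.cast_succ]
    linarith

end NLW

end

noncomputable section

namespace NLW

/-! ### The bi-characteristics as a subset of the Lorentz hyperboloid -/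

/-- The map `(n, j) ↦ (n · ω, j)` into `ℝ^{1+d}`. -/
def momentum {b d : ℕ} (j : Fin b → Fin d → ℤ) : Lattice b d →+ ℝ × (Fin d → ℝ) where
  toFun x := (phase (toReal j) x.1, fun m => (x.2 m : ℝ))
  map_zero' := by ext <;> simp [phase]
  map_add' x y := by ext <;> simp [phase, add_mul, Finset.sum_add_distrib]

/-- Squaring the defining equations removes the sign that separates the two sheets. -/
theorem lorentz_momentum {b d : ℕ} {j : Fin b → Fin d → ℤ} {x : Lattice b d}
    (hx : x ∈ charPlus j ∪ charMinus j) : lorentz d (momentum j x) (momentum j x) = 1 := by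
  have h0 : (0 : ℝ) ≤ ∑ m, (x.2 m : ℝ) ^ 2 + 1 :=
    add_nonneg (Finset.sum_nonneg fun m _ => sq_nonneg _) zero_le_one
  have h : phase (toReal j) x.1 ^ 2 = ∑ m, (x.2 m : ℝ) ^ 2 + 1 := by
    rw [← Real.sq_sqrt h0]
    rcases hx with hx | hx
    · rw [eq_neg_of_add_eq_zero_left hx, neg_sq]
    · rw [neg_add_eq_zero.1 hx]
  rw [lorentz_apply]
  simp only [momentum, AddMonoidHom.coe_mk, ZeroHom.coe_mk, dotProduct, ← sq]
  linarith

theorem disjoint_charPlus_charMinus {b d : ℕ} (j : Fin b → Fin d → ℤ) :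
    Disjoint (charPlus j) (charMinus j) := by
  refine Set.disjoint_left.2 fun x h h' => ?_
  have h0 : (0 : ℝ) < ∑ m, (x.2 m : ℝ) ^ 2 + 1 :=
    add_pos_of_nonneg_of_pos (Finset.sum_nonneg fun m _ => sq_nonneg _) one_pos
  have := Real.sqrt_pos.2 h0
  have h1 : phase (toReal j) x.1 + Real.sqrt (∑ m, (x.2 m : ℝ) ^ 2 + 1) = 0 := h
  have h2 : -phase (toReal j) x.1 + Real.sqrt (∑ m, (x.2 m : ℝ) ^ 2 + 1) = 0 := h'
  linarith

theorem momentum_site {b d : ℕ} (j : Fin b → Fin d → ℤ) (k : Fin b) :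
    momentum j (site j k) = (-omega (toReal j) k, toReal j k) := by
  ext m
  · simp [momentum, site, phase, Pi.single_apply]
  · rfl

theorem omega_pos {b d : ℕ} (J : Fin b → Fin d → ℝ) (k : Fin b) : 0 < omega J k :=
  Real.sqrt_pos.2 (add_pos_of_nonneg_of_pos (Finset.sum_nonneg fun _ _ => sq_nonneg _) one_pos)

/-- The Euclidean inner product with `v` on `ℝ^{1+d}`. -/
def euclid {d : ℕ} (v : ℝ × (Fin d → ℝ)) : (ℝ × (Fin d → ℝ)) →+ ℝ where
  toFun w := v.1 * w.1 + v.2 ⬝ᵥ w.2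
  map_zero' := by simp
  map_add' _ _ := by simp [dotProduct_add]; ring

/-- Expand `|w - v|² > 0`. -/
theorem euclid_lt {d : ℕ} {v w : ℝ × (Fin d → ℝ)} (h : euclid w w ≤ euclid v v) (hne : w ≠ v) :
    euclid v w < euclid v v := by
  have hpos : 0 < euclid (w - v) (w - v) := by
    simp only [euclid, AddMonoidHom.coe_mk, ZeroHom.coe_mk]
    by_contra hle
    have h1 := mul_self_nonneg (w - v).1
    have h2 : 0 ≤ (w - v).2 ⬝ᵥ (w - v).2 := Finset.sum_nonneg fun _ _ => mul_self_nonneg _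
    have h3 : (w - v).1 = 0 := mul_self_eq_zero.1 (by linarith)
    have h4 : (w - v).2 = 0 := dotProduct_self_eq_zero.1 (by linarith)
    exact hne (sub_eq_zero.1 (Prod.ext h3 h4))
  simp only [euclid, AddMonoidHom.coe_mk, ZeroHom.coe_mk, Prod.fst_sub, Prod.snd_sub,
    sub_dotProduct, dotProduct_sub] at hpos h ⊢
  rw [dotProduct_comm w.2 v.2] at hpos
  nlinarith

theorem euclid_neg_self {d : ℕ} (w : ℝ × (Fin d → ℝ)) : euclid (-w) (-w) = euclid w w := by
  simp [euclid]

/-- Since `ω_k² = |j_k|² + 1`, the longest `j_k` also gives the longest momentum. -/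
theorem euclid_momentum_site {b d : ℕ} (j : Fin b → Fin d → ℤ) (k : Fin b) :
    euclid (momentum j (site j k)) (momentum j (site j k)) = 2 * ∑ m, toReal j k m ^ 2 + 1 := by
  have h0 : (0 : ℝ) ≤ ∑ m, toReal j k m ^ 2 + 1 :=
    add_nonneg (Finset.sum_nonneg fun m _ => sq_nonneg _) zero_le_one
  simp only [momentum_site, euclid, AddMonoidHom.coe_mk, ZeroHom.coe_mk, dotProduct,
    ← sq, neg_sq]
  rw [omega, Real.sq_sqrt h0]
  ring

/-- The steps by which the Fourier support of `u⁽⁰⁾ + ū⁽⁰⁾` lies below its point `k₀`. -/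
def downSteps {b d : ℕ} (j : Fin b → Fin d → ℤ) (k₀ : Fin b) : Set (Lattice b d) :=
  {η | (∃ k, k ≠ k₀ ∧ η = -site j k₀ + site j k) ∨ ∃ k, η = -site j k₀ + -site j k}

theorem finite_downSteps {b d : ℕ} (j : Fin b → Fin d → ℤ) (k₀ : Fin b) :
    (downSteps j k₀).Finite := by
  refine ((Set.finite_range fun k => -site j k₀ + site j k).union
    (Set.finite_range fun k => -site j k₀ + -site j k)).subset ?_
  rintro _ (⟨k, -, rfl⟩ | ⟨k, rfl⟩)
  · exact Or.inl ⟨k, rfl⟩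
  · exact Or.inr ⟨k, rfl⟩

/-- The site with `|j_k|` maximal is a farthest point of the support, hence maximizes the inner
product with itself. Distinctness of the `j_k` rules out ties with other sites. -/
theorem exists_downSteps_neg {b d : ℕ} (hb : 0 < b) {j : Fin b → Fin d → ℤ}
    (hj : Function.Injective j) : ∃ (k₀ : Fin b) (l : (ℝ × (Fin d → ℝ)) →+ ℝ),
      ∀ η ∈ downSteps j k₀, l (momentum j η) < 0 := by
  obtain ⟨k₀, -, hk₀⟩ := Finset.exists_max_image Finset.univ
    (fun k => ∑ m, toReal j k m ^ 2) ⟨⟨0, hb⟩, Finset.mem_univ _⟩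
  have hle : ∀ k, euclid (momentum j (site j k)) (momentum j (site j k)) ≤
      euclid (momentum j (site j k₀)) (momentum j (site j k₀)) := by
    intro k
    rw [euclid_momentum_site, euclid_momentum_site]
    linarith [hk₀ k (Finset.mem_univ k)]
  refine ⟨k₀, euclid (momentum j (site j k₀)), ?_⟩
  rintro _ (⟨k, hk, rfl⟩ | ⟨k, rfl⟩)
  · have := euclid_lt (hle k) fun h => hk (hj ?_)
    · simp only [map_add, map_neg]
      linarith
    · rw [momentum_site, momentum_site] at h
      funext m
      exact Int.cast_injective (α := ℝ) (congrFun (congrArg Prod.snd h) m)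
  -- A tie with a reflected site, `k = k₀` included, would equate a positive frequency with a
  -- negative one.
  · have := euclid_lt ((euclid_neg_self _).trans_le (hle k)) fun h => ?_
    · simp only [map_add, map_neg] at this ⊢
      linarith
    · rw [momentum_site, momentum_site] at h
      have := congrArg Prod.fst h
      simp only [Prod.fst_neg] at this
      linarith [omega_pos (toReal j) k, omega_pos (toReal j) k₀]

/-- Recentring at `k₀` makes its own term the scalar `a k₀`; the other terms are shifts by
`downSteps`. -/
theorem isLocal_shift_mul_waveOp {b d : ℕ} (j : Fin b → Fin d → ℤ) (a : Fin b → ℝ) (k₀ : Fin b) :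
    IsLocal (downSteps j k₀) (shift (-site j k₀) * waveOp j a - (a k₀ : ℂ) • 1) := by
  have h : shift (-site j k₀) * waveOp j a - (a k₀ : ℂ) • 1 =
      ∑ k, (a k : ℂ) • shift (-site j k₀ + -site j k) +
        ∑ k ∈ Finset.univ.erase k₀, (a k : ℂ) • shift (-site j k₀ + site j k) := by
    rw [sub_eq_iff_eq_add, add_assoc, ← shift_zero, ← neg_add_cancel (site j k₀),
      Finset.sum_erase_add _ (fun k => (a k : ℂ) • shift (-site j k₀ + site j k))
        (Finset.mem_univ k₀), waveOp, Finset.mul_sum, ← Finset.sum_add_distrib]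
    refine Finset.sum_congr rfl fun k _ => ?_
    rw [mul_smul_comm, mul_add, shift_add, shift_add, smul_add, add_comm]
  rw [h]
  exact (IsLocal.sum _ fun k _ => (isLocal_shift (Or.inr ⟨k, rfl⟩)).smul _).add
    (IsLocal.sum _ fun k hk => (isLocal_shift (Or.inl ⟨k, Finset.ne_of_mem_erase hk, rfl⟩)).smul _)

/-- Compressions to the bi-characteristics of operators with decreasing steps are nilpotent. -/
theorem exists_pow_compression_eq_zero {b d : ℕ} (j : Fin b → Fin d → ℤ) {E : Set (Lattice b d)}
    (hE : E.Finite) (l : (ℝ × (Fin d → ℝ)) →+ ℝ) (hl : ∀ η ∈ E, l (momentum j η) < 0) :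
    ∃ N : ℕ, ∀ r : Ell2 b d →L[ℂ] Ell2 b d, IsLocal E r → ∀ ψ : Ell2 b d,
      ((proj (charPlus j ∪ charMinus j) * r * proj (charPlus j ∪ charMinus j)) ^ N)
        (proj (charPlus j ∪ charMinus j) ψ) = 0 := by
  obtain ⟨N, hN⟩ := exists_chain_bound (hE.image fun η => -momentum j η)
  refine ⟨N, fun r hr ψ => ?_⟩
  ext x
  by_contra hx
  obtain ⟨w, -, hwE, hwS⟩ := hr.exists_chain N ψ x hx
  refine hN (fun i => momentum j (w i)) (fun i hi => ⟨_, hwE i hi, ?_⟩)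
    (fun i hi => lorentz_momentum (hwS i hi)) ?_
  · simp
  -- The chain is traversed against the steps, so `l` increases and the points are distinct.
  · have hmono : StrictMonoOn (fun i => l (momentum j (w i))) (Set.Iic N) := by
      refine strictMonoOn_of_lt_add_one Set.ordConnected_Iic fun i _ _ hi => ?_
      have := hl _ (hwE i (Nat.lt_of_succ_le hi))
      simp only [map_sub] at this
      linarith
    exact fun i hi i' hi' h => hmono.injOn hi hi' (congrArg l h)

end NLW

end

/-! ### Lower bound on the bi-characteristics and inversion of the compression -/

noncomputable section

namespace NLW

/-- `K` and `q` do not depend on `a`; the ratio `‖a‖ / a k₀` is paid for by powers of `η`. -/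
theorem exists_norm_le_waveOp_pow {b d m : ℕ} (hb : 0 < b) (hm : 0 < m)
    {j : Fin b → Fin d → ℤ} (hj : Function.Injective j) :
    ∃ (k₀ : Fin b) (K : ℝ) (q : ℕ), 0 < K ∧ 0 < q ∧ ∀ a : Fin b → ℝ, 0 < a k₀ →
      ∀ η : ℝ, 0 < η → η * ‖a‖ ≤ a k₀ →
        ∀ φ : Ell2 b d, proj (charPlus j ∪ charMinus j) φ = φ →
          η ^ q * ‖a‖ ^ m * ‖φ‖ ≤ K * ‖(waveOp j a ^ m) φ‖ := by
  obtain ⟨k₀, l, hl⟩ := exists_downSteps_neg hb hj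
  obtain ⟨N, hN⟩ := exists_pow_compression_eq_zero j
    (finite_powSteps (finite_downSteps j k₀) m) l
    (neg_of_mem_powSteps (l.comp (momentum j)) hl m)
  have hb1 : (1 : ℝ) ≤ b := by exact_mod_cast hb
  -- The exponent `m` pays for dividing by `a k₀ ^ m`, and `m * N` for `κ ^ N` below; `N + 1` keeps
  -- the constant positive if `N = 0`.
  refine ⟨k₀, (N + 1) * (2 ^ N * (2 * b) ^ (m * N)), m + m * N, by positivity, by omega, ?_⟩
  intro a ha η hη hηa φ hφ
  set S := charPlus j ∪ charMinus j
  set h := shift (-site j k₀) * waveOp j a with hh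
  set r := h ^ m - (a k₀ : ℂ) ^ m • (1 : Ell2 b d →L[ℂ] Ell2 b d) with hr
  have hak : a k₀ ≤ ‖a‖ := (le_abs_self _).trans (norm_le_pi_norm a k₀)
  have hak' : ‖(a k₀ : ℂ)‖ = a k₀ := by rw [Complex.norm_real, Real.norm_of_nonneg ha.le]
  have ha0 : (a k₀ : ℂ) ^ m ≠ 0 := pow_ne_zero _ (Complex.ofReal_ne_zero.2 ha.ne')
  -- Commutativity gives `h ^ m = shift ^ m * waveOp ^ m`, and shifts do not increase norms.
  have hcomm : Commute (shift (-site j k₀)) (waveOp j a) := by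
    rw [← one_smul ℂ (shift (-site j k₀)), ← convHom_single, ← convHom_uHat_add_uBarHat]
    exact (Commute.all _ _).map (convHom b d)
  have hle1 : ∀ n (f : Ell2 b d), ‖(shift (-site j k₀) ^ n) f‖ ≤ ‖f‖ := by
    intro n
    induction n with
    | zero => exact fun f => le_rfl
    | succ n ih =>
      intro f
      rw [pow_succ, mul_apply_eq_comp]
      exact (ih _).trans (((shift _).le_of_opNorm_le (norm_shift_le _) f).trans_eq (one_mul _))
  have hhφ : ‖(h ^ m) φ‖ ≤ ‖(waveOp j a ^ m) φ‖ := by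
    rw [hh, hcomm.mul_pow, mul_apply_eq_comp]
    exact hle1 m _
  have hhn : ‖h‖ ≤ 2 * b * ‖a‖ := by
    refine (norm_mul_le _ _).trans ?_
    refine (mul_le_mul (norm_shift_le _) (norm_waveOp_le j a) (norm_nonneg _) zero_le_one).trans ?_
    rw [one_mul]
  have hrn : ‖r‖ ≤ 2 * (2 * b * ‖a‖) ^ m := by
    have h1 : ‖h ^ m‖ ≤ (2 * b * ‖a‖) ^ m :=
      (norm_pow_le' h hm).trans (pow_le_pow_left₀ (norm_nonneg _) hhn m)
    have h2 : ‖(a k₀ : ℂ) ^ m • (1 : Ell2 b d →L[ℂ] Ell2 b d)‖ ≤ (2 * b * ‖a‖) ^ m := by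
      rw [norm_smul, norm_pow, hak']
      have h3 : a k₀ ≤ 2 * b * ‖a‖ := by nlinarith [norm_nonneg a]
      refine (mul_le_of_le_one_right (pow_nonneg ha.le _) ContinuousLinearMap.norm_id_le).trans ?_
      exact pow_le_pow_left₀ ha.le h3 m
    linarith [norm_sub_le (h ^ m) ((a k₀ : ℂ) ^ m • (1 : Ell2 b d →L[ℂ] Ell2 b d))]
  have hPrP : ‖proj S * r * proj S‖ ≤ 2 * (2 * b * ‖a‖) ^ m := by
    have h1 : ‖proj S * r‖ ≤ ‖r‖ :=
      (norm_mul_le _ _).trans (mul_le_of_le_one_left (norm_nonneg _) (norm_proj_le S))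
    exact (norm_mul_le _ _).trans
      ((mul_le_of_le_one_right (norm_nonneg _) (norm_proj_le S)).trans (h1.trans hrn))
  set κ : ℝ := 2 * (2 * b * (‖a‖ / a k₀)) ^ m with hκ
  have hκeq : (a k₀ ^ m)⁻¹ * (2 * (2 * b * ‖a‖) ^ m) = κ := by
    rw [hκ, ← mul_div_assoc, div_pow]
    ring
  have hκ1 : 1 ≤ κ := by
    have h1 : 1 ≤ ‖a‖ / a k₀ := (one_le_div ha).2 hak
    have h2 : (1 : ℝ) ≤ (2 * b * (‖a‖ / a k₀)) ^ m := one_le_pow₀ (by nlinarith)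
    linarith
  have hnorm : ‖((a k₀ : ℂ) ^ m)⁻¹‖ = (a k₀ ^ m)⁻¹ := by rw [norm_inv, norm_pow, hak']
  have hfix : φ = ((a k₀ : ℂ) ^ m)⁻¹ • proj S ((h ^ m) φ) -
      (((a k₀ : ℂ) ^ m)⁻¹ • (proj S * r * proj S)) φ := by
    have h1 : (proj S * r * proj S) φ = proj S ((h ^ m) φ) - (a k₀ : ℂ) ^ m • φ := by
      change proj S (r (proj S φ)) = _
      rw [hφ, hr, sub_apply, map_sub, smul_apply, one_apply_eq_self, map_smul, hφ]
    rw [smul_apply, h1, smul_sub, sub_sub_cancel, inv_smul_smul₀ ha0]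
  have hzero : ((((a k₀ : ℂ) ^ m)⁻¹ • (proj S * r * proj S)) ^ N) φ = 0 := by
    have := hN r ((isLocal_shift_mul_waveOp j a k₀).pow_sub m) φ
    rw [hφ] at this
    rw [smul_pow, smul_apply, this, smul_zero]
  have hmain := norm_le_of_eq_sub hfix (κ := κ) (by
    rw [norm_smul, hnorm, ← hκeq]
    exact mul_le_mul_of_nonneg_left hPrP (by positivity)) hκ1 N
  rw [hzero, norm_zero, add_zero, norm_smul, hnorm] at hmain
  have hP : ‖proj S ((h ^ m) φ)‖ ≤ ‖(waveOp j a ^ m) φ‖ :=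
    ((proj S).le_of_opNorm_le (norm_proj_le S) _).trans ((one_mul _).trans_le hhφ)
  have hmain' : ‖φ‖ ≤ (N + 1) * κ ^ N * ((a k₀ ^ m)⁻¹ * ‖(waveOp j a ^ m) φ‖) := by
    refine hmain.trans ?_
    gcongr
    linarith
  have ht : η * (‖a‖ / a k₀) ≤ 1 := by
    rw [← mul_div_assoc]
    exact (div_le_one ha).2 hηa
  calc η ^ (m + m * N) * ‖a‖ ^ m * ‖φ‖
      ≤ η ^ (m + m * N) * ‖a‖ ^ m *
          ((N + 1) * κ ^ N * ((a k₀ ^ m)⁻¹ * ‖(waveOp j a ^ m) φ‖)) := by gcongr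
    _ = (η * (‖a‖ / a k₀)) ^ (m + m * N) *
          ((N + 1) * (2 ^ N * (2 * b) ^ (m * N)) * ‖(waveOp j a ^ m) φ‖) := by
        rw [hκ, mul_pow 2, ← pow_mul, mul_pow (2 * (b : ℝ)), mul_pow η, pow_add (‖a‖ / a k₀),
          div_pow _ _ m]
        ring
    _ ≤ _ := mul_le_of_le_one_left (by positivity) (pow_le_one₀ (by positivity) ht)

/-! ### The block operator -/

theorem P_apply {b d : ℕ} (j : Fin b → Fin d → ℤ) (x : Ell2Pair b d) :
    P j x = WithLp.toLp 2 (proj (charPlus j) x.fst, proj (charMinus j) x.snd) := rfl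

theorem A0_apply {b d : ℕ} (p : ℕ) (j : Fin b → Fin d → ℤ) (a : Fin b → ℝ) (x : Ell2Pair b d) :
    A0 p j a x = WithLp.toLp 2
      ((waveOp j a ^ p) (x.fst + x.snd), (waveOp j a ^ p) (x.fst + x.snd)) := by
  have h : conv ((uHat j a + uBarHat j a) ^ p) = waveOp j a ^ p := by
    rw [conv_eq_convHom, map_pow, convHom_uHat_add_uBarHat]
  rw [← h, map_add]
  rfl

theorem P_P {b d : ℕ} (j : Fin b → Fin d → ℤ) (x : Ell2Pair b d) : P j (P j x) = P j x := by
  rw [P_apply, P_apply]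
  exact congrArg (WithLp.toLp 2) (Prod.ext (proj_proj _ _) (proj_proj _ _))

theorem inner_proj_left {b d : ℕ} (S : Set (Lattice b d)) (f g : Ell2 b d) :
    inner ℂ (proj S f) g = inner ℂ f (proj S g) := by
  rw [lp.inner_eq_tsum, lp.inner_eq_tsum]
  congr 1
  ext x
  rw [proj_apply, proj_apply]
  by_cases hx : x ∈ S <;> simp [hx]

theorem inner_P_left {b d : ℕ} (j : Fin b → Fin d → ℤ) (x y : Ell2Pair b d) :
    inner ℂ (P j x) y = inner ℂ x (P j y) := by
  simp only [P_apply, WithLp.prod_inner_apply, inner_proj_left]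
  rfl

theorem proj_of_subset {b d : ℕ} {S T : Set (Lattice b d)} (hST : S ⊆ T) {f : Ell2 b d}
    (hf : proj S f = f) : proj T f = f := by
  rw [← hf]
  ext x
  simp only [proj_apply]
  by_cases hx : x ∈ S
  · simp [hx, hST hx]
  · simp [hx]

theorem proj_eq_zero_of_disjoint {b d : ℕ} {S T : Set (Lattice b d)} (hST : Disjoint S T)
    {f : Ell2 b d} (hf : proj T f = f) : proj S f = 0 := by
  rw [← hf]
  ext x
  simp only [proj_apply]
  by_cases hx : x ∈ S
  · simp [hx, Set.disjoint_left.1 hST hx]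
  · simp [hx]

/-- All four blocks agree, so the form sees only `x.fst + x.snd`, whose summands are orthogonal. -/
theorem le_re_inner_A0 {b d m : ℕ} {j : Fin b → Fin d → ℤ} {a : Fin b → ℝ} {c : ℝ}
    (h : ∀ φ : Ell2 b d, proj (charPlus j ∪ charMinus j) φ = φ →
      c * ‖φ‖ ^ 2 ≤ ‖(waveOp j a ^ m) φ‖ ^ 2) {x : Ell2Pair b d} (hx : P j x = x) :
    c * ‖x‖ ^ 2 ≤ (inner ℂ (A0 (m + m) j a x) x).re := by
  have h1 : proj (charPlus j) x.fst = x.fst := congrArg (fun y : Ell2Pair b d => y.fst) hx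
  have h2 : proj (charMinus j) x.snd = x.snd := congrArg (fun y : Ell2Pair b d => y.snd) hx
  have h3 : proj (charPlus j ∪ charMinus j) (x.fst + x.snd) = x.fst + x.snd := by
    rw [map_add, proj_of_subset Set.subset_union_left h1,
      proj_of_subset Set.subset_union_right h2]
  have horth : inner ℂ x.fst x.snd = 0 := by
    rw [← h1, inner_proj_left, proj_eq_zero_of_disjoint (disjoint_charPlus_charMinus j) h2,
      inner_zero_right]
  have h4 : ‖x.fst + x.snd‖ ^ 2 = ‖x‖ ^ 2 := by
    rw [WithLp.prod_norm_sq_eq_of_L2, sq, sq, sq,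
      norm_add_sq_eq_norm_sq_add_norm_sq_of_inner_eq_zero _ _ horth]
  have h5 : inner ℂ (A0 (m + m) j a x) x = (‖(waveOp j a ^ m) (x.fst + x.snd)‖ ^ 2 : ℂ) := by
    rw [A0_apply, WithLp.prod_inner_apply, ← inner_waveOp_pow_self, inner_add_right]
    rfl
  rw [h5, ← h4, ← Complex.ofReal_pow, Complex.ofReal_re]
  exact h _ h3

/-- A compression that is coercive on the range of the projection is invertible there. -/
theorem exists_isCompressionInverse {b d : ℕ} {Q T : Ell2Pair b d →L[ℂ] Ell2Pair b d}
    (hQQ : ∀ x, Q (Q x) = Q x) (hQ : ∀ x y, inner ℂ (Q x) y = inner ℂ x (Q y))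
    {c : ℝ} (hc : 0 < c) (hT : ∀ x, Q x = x → c * ‖x‖ ^ 2 ≤ (inner ℂ (T x) x).re) :
    ∃ R, IsCompressionInverse Q T R ∧ ‖R‖ ≤ c⁻¹ := by
  -- The term `c (1 - Q)` extends coercivity to the whole space, so `f` is invertible; `f` commutes
  -- with `Q`, hence so does its inverse.
  set f : Ell2Pair b d →L[ℂ] Ell2Pair b d := Q * T * Q + (c : ℂ) • (1 - Q) with hf
  have hQQ' : Q * Q = Q := ContinuousLinearMap.ext hQQ
  have horth : ∀ x, inner ℂ (Q x) (x - Q x) = 0 := fun x => by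
    rw [hQ, map_sub, hQQ, sub_self, inner_zero_right]
  have hpyth : ∀ x, ‖x‖ ^ 2 = ‖Q x‖ ^ 2 + ‖x - Q x‖ ^ 2 := fun x => by
    have := norm_add_sq_eq_norm_sq_add_norm_sq_of_inner_eq_zero _ _ (horth x)
    rwa [add_sub_cancel, ← sq, ← sq, ← sq] at this
  have hcoer : ∀ x, c * ‖x‖ ^ 2 ≤ (inner ℂ (f x) x).re := by
    intro x
    have h1 : inner ℂ (x - Q x) x = (‖x - Q x‖ ^ 2 : ℂ) := by
      calc inner ℂ (x - Q x) x = inner ℂ (x - Q x) (x - Q x + Q x) := by rw [sub_add_cancel]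
        _ = _ := by
          rw [inner_add_right, ← inner_conj_symm _ (Q x), horth, map_zero, add_zero,
            inner_self_eq_norm_sq_to_K]
          rfl
    have h2 : inner ℂ (f x) x = inner ℂ (T (Q x)) (Q x) + (c * ‖x - Q x‖ ^ 2 : ℂ) := by
      change inner ℂ (Q (T (Q x)) + (c : ℂ) • (x - Q x)) x = _
      rw [inner_add_left, hQ, inner_smul_left, Complex.conj_ofReal, h1]
    have h4 := hT (Q x) (hQQ x)
    rw [h2, Complex.add_re, ← Complex.ofReal_pow, ← Complex.ofReal_mul, Complex.ofReal_re, hpyth]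
    linarith
  obtain ⟨u, hu⟩ := f.isUnit_of_forall_le_norm_inner_map (c := ⟨c, hc.le⟩) hc fun x =>
    (mul_comm _ _).trans_le ((hcoer x).trans (Complex.re_le_norm _))
  have hfQ : f * Q = Q * T * Q := by
    rw [hf, add_mul, mul_assoc (Q * T), hQQ', smul_mul_assoc, sub_mul, hQQ', one_mul, sub_self,
      smul_zero, add_zero]
  have hQf : Q * f = Q * T * Q := by
    rw [hf, mul_add, ← mul_assoc, ← mul_assoc, hQQ', mul_smul_comm, mul_sub, hQQ', mul_one,
      sub_self, smul_zero, add_zero]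
  have huf : (↑u⁻¹ : Ell2Pair b d →L[ℂ] Ell2Pair b d) * f = 1 := hu ▸ u.inv_mul
  have hfu : f * (↑u⁻¹ : Ell2Pair b d →L[ℂ] Ell2Pair b d) = 1 := hu ▸ u.mul_inv
  set g : Ell2Pair b d →L[ℂ] Ell2Pair b d := ↑u⁻¹
  have hcomm : Q * g = g * Q := by
    rw [← one_mul (Q * g), ← huf, mul_assoc, ← mul_assoc f, hfQ, ← hQf, mul_assoc Q, hfu, mul_one]
  refine ⟨g * Q, ⟨?_, ?_, ?_, ?_⟩, ?_⟩
  · change Q * (g * Q) = g * Q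
    rw [← mul_assoc, hcomm, mul_assoc, hQQ']
  · change g * Q * Q = g * Q
    rw [mul_assoc, hQQ']
  · change g * Q * (Q * T * Q) = Q
    rw [← hQf, ← mul_assoc, mul_assoc g, hQQ', ← hcomm, mul_assoc, huf, mul_one]
  · change Q * T * Q * (g * Q) = Q
    rw [← hQf, mul_assoc, ← mul_assoc f, hfu, one_mul, hQQ']
  · refine ContinuousLinearMap.opNorm_le_bound _ (by positivity) fun x => ?_
    have hfx : f ((g * Q) x) = Q x := by
      change (f * (g * Q)) x = Q x
      rw [← mul_assoc, hfu, one_mul]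
    have hQx : ‖Q x‖ ≤ ‖x‖ :=
      abs_le_of_sq_le_sq' (by linarith [hpyth x, sq_nonneg ‖x - Q x‖]) (norm_nonneg x) |>.2
    have h1 := hcoer ((g * Q) x)
    rw [hfx] at h1
    have h2 := h1.trans ((Complex.re_le_norm _).trans (norm_inner_le_norm _ _))
    have h3 := h2.trans (mul_le_mul_of_nonneg_right hQx (norm_nonneg _))
    rw [sq, ← mul_assoc] at h3
    rw [inv_mul_eq_div, le_div_iff₀ hc, mul_comm]
    rcases (norm_nonneg ((g * Q) x)).eq_or_lt with h0 | h0
    · rw [← h0, mul_zero]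
      exact norm_nonneg x
    · exact le_of_mul_le_mul_right h3 h0

end NLW

end

/-- Amplitudes are `a : Fin b → ℝ`, so `‖a‖` is the sup norm and `volume` is Lebesgue measure. -/
theorem proposition1 {b d p : ℕ} (hb : 0 < b) (hp : 0 < p) (hpe : Even p)
    (j : Fin b → Fin d → ℤ) (hj : ∀ k, j k ≠ 0) (hgen : NLW.Generic p j) :
    ∃ C c : ℝ, 0 < C ∧ 0 < c ∧
      ∀ ε : ℝ, 0 < ε → ∀ δ : ℝ, 0 < δ → δ ≤ 1 →
        ∃ S : Set (Fin b → ℝ),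
          S ⊆ {a | ∀ k, 0 < a k ∧ a k ≤ δ} ∧
          MeasurableSet S ∧
          1 - C * ε ^ c < (MeasureTheory.volume S).toReal / δ ^ b ∧
          ∀ a ∈ S, ∃ R : NLW.Ell2Pair b d →L[ℂ] NLW.Ell2Pair b d,
            NLW.IsCompressionInverse (NLW.P j) (NLW.A0 p j a) R ∧
            ‖R‖ ≤ (ε * ‖a‖ ^ p)⁻¹ := by

  obtain ⟨m, rfl⟩ := hpe
  have hm : 0 < m := by omega
  obtain ⟨k₀, K, q, hK, hq, hlow⟩ := NLW.exists_norm_le_waveOp_pow hb hm hgen.injective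
  have hq' : (0 : ℝ) < 2 * q := by positivity
  -- Chosen so that `η ^ (2q) / K ^ 2 = ε`, as squaring the lower bound requires. The factor 2 makes
  -- the measure estimate strict.
  refine ⟨2 * (K ^ 2) ^ (1 / (2 * q : ℝ)), 1 / (2 * q : ℝ), by positivity, by positivity, ?_⟩
  intro ε hε δ hδ _
  set η : ℝ := (K ^ 2 * ε) ^ (1 / (2 * q : ℝ)) with hη
  have hη0 : 0 < η := by positivity
  have hηq : η ^ (2 * q) = K ^ 2 * ε := by
    rw [hη, ← Real.rpow_natCast, ← Real.rpow_mul (by positivity)]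
    push_cast
    rw [one_div_mul_cancel hq'.ne', Real.rpow_one]
  have hCε : 2 * (K ^ 2) ^ (1 / (2 * q : ℝ)) * ε ^ (1 / (2 * q : ℝ)) = 2 * η := by
    rw [hη, Real.mul_rpow (by positivity) hε.le, mul_assoc]
  -- Only the coordinate `k₀` is kept away from zero. The minimum with 1 covers large `ε`, where the
  -- box is empty.
  set lo : Fin b → ℝ := Pi.single k₀ (min η 1 * δ) with hlo
  have hlo_le : lo ≤ fun _ => δ := by
    intro k
    rcases eq_or_ne k k₀ with rfl | hk
    · rw [hlo, Pi.single_eq_same]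
      exact mul_le_of_le_one_left hδ.le (min_le_right _ _)
    · rw [hlo, Pi.single_eq_of_ne hk]
      exact hδ.le
  have hlo_nonneg : ∀ k, 0 ≤ lo k := by
    intro k
    rcases eq_or_ne k k₀ with rfl | hk
    · rw [hlo, Pi.single_eq_same]
      positivity
    · rw [hlo, Pi.single_eq_of_ne hk]
  refine ⟨Set.univ.pi fun k => Set.Ioc (lo k) δ, ?_,
    MeasurableSet.univ_pi fun _ => measurableSet_Ioc, ?_, ?_⟩
  · exact fun a ha k => ⟨(hlo_nonneg k).trans_lt (ha k trivial).1, (ha k trivial).2⟩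
  · have hvol : ∏ k, (δ - lo k) = (1 - min η 1) * δ ^ b := by
      have h1 : ∏ k ∈ Finset.univ.erase k₀, (δ - lo k) = δ ^ (b - 1) := by
        rw [Finset.prod_congr rfl fun k hk => by
          rw [hlo, Pi.single_eq_of_ne (Finset.ne_of_mem_erase hk), sub_zero]]
        simp
      rw [← Finset.mul_prod_erase _ _ (Finset.mem_univ k₀), h1, hlo, Pi.single_eq_same,
        ← Nat.sub_add_cancel hb, Nat.add_sub_cancel, pow_succ]
      ring
    rw [Real.volume_pi_Ioc_toReal hlo_le, hvol, mul_div_cancel_right₀ _ (by positivity), hCε]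
    linarith [min_le_left η 1]
  · intro a ha
    have hak : η * ‖a‖ ≤ a k₀ ∧ 0 < ‖a‖ := by
      have h1 := (ha k₀ trivial).1
      have h2 := (ha k₀ trivial).2
      rw [hlo, Pi.single_eq_same] at h1
      -- A point of the box exists, so the minimum is `η`.
      have h3 : min η 1 < 1 := lt_of_mul_lt_mul_right (by linarith) hδ.le
      have h4 : η < 1 := (min_lt_iff.1 h3).resolve_right (lt_irrefl _)
      rw [min_eq_left h4.le] at h1
      have h5 : ‖a‖ ≤ δ := (pi_norm_le_iff_of_nonneg hδ.le).2 fun k => by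
        rw [Real.norm_of_nonneg ((hlo_nonneg k).trans (ha k trivial).1.le)]
        exact (ha k trivial).2
      have h6 : 0 < a k₀ := lt_trans (by positivity) h1
      exact ⟨(mul_le_mul_of_nonneg_left h5 hη0.le).trans h1.le,
        h6.trans_le ((le_abs_self _).trans (norm_le_pi_norm a k₀))⟩
    obtain ⟨hηa, ha0⟩ := hak
    refine NLW.exists_isCompressionInverse (NLW.P_P j) (NLW.inner_P_left j) (by positivity)
      fun x hx => NLW.le_re_inner_A0 (fun φ hφ => ?_) hx
    have h1 := hlow a ((mul_pos hη0 ha0).trans_le hηa) η hη0 hηa φ hφ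
    have h2 := pow_le_pow_left₀ (by positivity) h1 2
    have h3 : (η ^ q * ‖a‖ ^ m * ‖φ‖) ^ 2 = K ^ 2 * (ε * ‖a‖ ^ (m + m) * ‖φ‖ ^ 2) := by
      rw [mul_pow, mul_pow, ← pow_mul, mul_comm q, hηq]
      ring
    rw [h3, mul_pow] at h2
    exact le_of_mul_le_mul_left h2 (by positivity)
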